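/- Let $d\ge 1$ and $k\ge 1$ be integers and let $\lambda_b,\upsilon,\alpha,\mu>0$. Put $\delta=d/\upsilon$, $c_d=\pi^{d/2}/\Gamma(1+d/2)$ (the volume of the unit ball of $\mathbb R^d$), $A=c_d\lambda_b$ (so $A=\pi\lambda_b$ when $d=2$), $\Omega=\Gamma(\mu)/\Gamma(\mu+2/\alpha)$, $\epsilon=1/(\Omega\,\Gamma(\mu))$ and $\theta=1/\Omega$. Let $\Phi$ be a homogeneous Poisson point process on $\mathbb R^d$ with intensity $\lambda_b$, let $r_k$ be the distance from the origin to its $k$-th nearest point, and let $g_k$ be a random variable independent of $r_k$ with density $$f_{g}(x)=\frac{\alpha x^{\alpha\mu/2-1}}{2\,\Omega^{\alpha\mu/2}\,\Gamma(\mu)}\exp\!\Big(-\big(x/\Omega\big)^{\alpha/2}\Big)\quad(x>0),\qquad f_g(x)=0\quad(x\le 0).$$ Let $Z=g_k/r_k^{\upsilon}$. Then $Z$ is almost surely positive and has a density $f_Z$ (zero on $z\le 0$), and for every $z>0$ $$f_Z(z)=\frac{\epsilon}{A^{1/\delta}\,\Gamma(k)}\,H^{1,1}_{1,1}\!\left[\frac{\theta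 z}{A^{1/\delta}}\,\middle|\,\begin{matrix}(1-k-\frac1\delta,\frac1\delta)\\(\mu-\frac2\alpha,\frac2\alpha)\end{matrix}\right],$$ $$P(Z\le z)=1-\frac{\epsilon}{\theta\,\Gamma(k)}\,H^{2,1}_{2,2}\!\left[\frac{\theta z}{A^{1/\delta}}\,\middle|\,\begin{matrix}(1-k,\frac1\delta),(1,1)\\(0,1),(\mu,\frac2\alpha)\end{matrix}\right].$$ Here, for $x>0$, Fox's $H$-function is $$H^{m,n}_{p,q}\!\left[x\,\middle|\,\begin{matrix}(a_j,A_j)_{j=1}^{p}\\(b_j,B_j)_{j=1}^{q}\end{matrix}\right]=\frac1{2\pi i}\int_{c-i\infty}^{c+i\infty}\frac{\prod_{j=1}^m\Gamma(b_j+B_js)\prod_{j=1}^n\Gamma(1-a_j-A_js)}{\prod_{j=n+1}^p\Gamma(a_j+A_js)\prod_{j=m+1}^q\Gamma(1-b_j-B_js)}\,x^{-s}\,ds,$$ where the line $\operatorname{Re}s=c$ has the poles of the $\Gamma(b_j+B_js)$, $j\le m$, on its left and those of the $\Gamma(1-a_j-A_js)$, $j\le n$, on its right. For both functions above such lines exist,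 and along each of them the integral converges absolutely, to a value that does not depend on the line. -/

import Mathlib

open MeasureTheory ProbabilityTheory Set

noncomputable section

/-- The Mellin-Barnes kernel of Fox's `H^{m,n}_{p,q}[ · | (a_j, A_j)_{j ≤ p}; (b_j, B_j)_{j ≤ q}]`
(indices are shifted to start from `0`):
`∏_{j < m} Γ(b_j + B_j s) ∏_{j < n} Γ(1 - a_j - A_j s)` divided by
`∏_{j ≥ n} Γ(a_j + A_j s) ∏_{j ≥ m} Γ(1 - b_j - B_j s)`.
Mathlib's `Γ` is `0` at its poles and `x / 0 = 0`, which gives the usual value `0` of `1 / Γ`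
there. -/
def foxKernel (m n : ℕ) {p q : ℕ} (a : Fin p → ℂ × ℝ) (b : Fin q → ℂ × ℝ) (s : ℂ) : ℂ :=
  ((∏ j : Fin q with j.val < m, Complex.Gamma ((b j).1 + ((b j).2 : ℂ) * s)) *
    ∏ j : Fin p with j.val < n, Complex.Gamma (1 - (a j).1 - ((a j).2 : ℂ) * s)) /
  ((∏ j : Fin p with n ≤ j.val, Complex.Gamma ((a j).1 + ((a j).2 : ℂ) * s)) *
    ∏ j : Fin q with m ≤ j.val, Complex.Gamma (1 - (b j).1 - ((b j).2 : ℂ) * s))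

/-- The vertical line `Re s = c` separates the poles `s = -(b_j + ν) / B_j` (`j < m`) of the
factors `Γ(b_j + B_j s)`, which lie strictly to its left, from the poles
`s = (1 - a_j + ν) / A_j` (`j < n`) of the factors `Γ(1 - a_j - A_j s)`, which lie strictly to
its right. -/
def FoxSeparates (m n : ℕ) {p q : ℕ} (a : Fin p → ℂ × ℝ) (b : Fin q → ℂ × ℝ) (c : ℝ) : Prop :=
  (∀ j : Fin q, j.val < m → ∀ ν : ℕ, (-((b j).1 + (ν : ℂ)) / ((b j).2 : ℂ)).re < c) ∧
  (∀ j : Fin p, j.val < n → ∀ ν : ℕ, c < ((1 - (a j).1 + (ν : ℂ)) / ((a j).2 : ℂ)).re)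

open Classical in
/-- Fox's `H`-function at a positive real argument `z`:
`(1 / 2πi) ∫_L foxKernel(s) z^{-s} ds`, where the contour `L` runs upwards along a vertical line
that separates the two families of poles. (`mellinInv c φ z` is
`(1 / 2π) ∫ z^{-(c + iy)} φ(c + iy) dy`.) -/
def foxH (m n : ℕ) {p q : ℕ} (a : Fin p → ℂ × ℝ) (b : Fin q → ℂ × ℝ) (z : ℝ) : ℂ :=
  if h : ∃ c : ℝ, FoxSeparates m n a b c then mellinInv h.choose (foxKernel m n a b) z else 0

/-- Fox's `H`-function is properly defined at `z`: a separating vertical line exists, and along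
every such line the Mellin-Barnes integral converges absolutely, to the same value `foxH`. -/
def FoxHWellDefined (m n : ℕ) {p q : ℕ} (a : Fin p → ℂ × ℝ) (b : Fin q → ℂ × ℝ) (z : ℝ) : Prop :=
  (∃ c : ℝ, FoxSeparates m n a b c) ∧
  ∀ c : ℝ, FoxSeparates m n a b c →
    Complex.VerticalIntegrable (fun s => (z : ℂ) ^ (-s) * foxKernel m n a b s) c ∧
    mellinInv c (foxKernel m n a b) z = foxH m n a b z

/-- A homogeneous Poisson point process of intensity `lam` on `ℝ^d`, as a random set of points:
it is almost surely locally finite, the numbers of points in Borel sets are random variables,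
the number of points in a Borel set `B` of finite volume is Poisson distributed with mean
`lam * vol B`, and the numbers of points in disjoint Borel sets are independent. -/
structure IsHomogeneousPPP {Ω : Type*} [MeasurableSpace Ω] (P : Measure Ω) {d : ℕ}
    (lam : ℝ) (Φ : Ω → Set (EuclideanSpace ℝ (Fin d))) : Prop where
  locallyFinite : ∀ᵐ ω ∂P, ∀ R : ℝ, (Φ ω ∩ Metric.closedBall 0 R).Finite
  measurable_count : ∀ B, MeasurableSet B → Measurable fun ω => (Φ ω ∩ B).encard
  poisson_count : ∀ B, MeasurableSet B → volume B ≠ ⊤ → ∀ n : ℕ,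
    P {ω | (Φ ω ∩ B).encard = (n : ℕ∞)} =
      ENNReal.ofReal
        (Real.exp (-(lam * volume.real B)) * (lam * volume.real B) ^ n / (n.factorial : ℝ))
  indep_count : ∀ (N : ℕ) (B : Fin N → Set (EuclideanSpace ℝ (Fin d))),
    (∀ i, MeasurableSet (B i)) → Pairwise (fun i j => Disjoint (B i) (B j)) →
    iIndepFun (fun i ω => (Φ ω ∩ B i).encard) P

/-- The distance from the origin to the `k`-th nearest point of a locally finite set: the
smallest radius `ρ` for which the closed ball of radius `ρ` has at least `k` of its points. -/
def kthNearestDist {d : ℕ} (S : Set (EuclideanSpace ℝ (Fin d))) (k : ℕ) : ℝ :=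
  sInf {ρ : ℝ | 0 ≤ ρ ∧ (k : ℕ∞) ≤ (S ∩ Metric.closedBall 0 ρ).encard}

/-- The density of the `α-μ` power gain with scale `Om`; it vanishes for `x ≤ 0`. -/
def alphaMuPowerPDF (α μ Om : ℝ) (x : ℝ) : ℝ :=
  if 0 < x then
    α * x ^ (α * μ / 2 - 1) / (2 * Om ^ (α * μ / 2) * Real.Gamma μ) *
      Real.exp (-(x / Om) ^ (α / 2))
  else 0

end

/-!
The gain-to-loss ratio is `Z = g / T` with `T = r ^ υ`. Both factors are powers of gamma
variables. The number of points in a ball of radius `ρ` is Poisson with mean `A * ρ ^ d`, and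
`r ≤ ρ` exactly when this number is at least `k`, so `A * r ^ d = A * T ^ δ` has the Erlang law of
shape `k` (`IsHomogeneousPPP.hasLaw_kthNearestDist`). The density of `g` is that of a gamma
variable of shape `μ` under `y ↦ Om * y ^ (2 / α)`. By independence the complex moments of `Z` are
`E[Z ^ w] = κ ^ w * Γ(μ + 2w/α) * Γ(k - w/δ) / (Γ(μ) * Γ(k))` with `κ = Om * A ^ (1 / δ)`, as long
as both Gamma arguments have positive real part (`moment_alphaMuPower`, `moment_of_gamma_rpow`).

Conditioning on `T` gives `Z` the density `f(z) = E[T * p(z * T)]`, with `p` the density of `g`.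
It is continuous on `(0, ∞)` because `x * p(x)` is bounded (`continuousAt_ratioPDF`). Its Mellin
transform is `E[Z ^ (s - 1)]`, and the Mellin transform of the tail `P(Z > z)` is `E[Z ^ s] / s`
(`hasMellin_measureReal_Ioi`). Up to a constant and the factor `κ ^ s`, these are the kernels of
the two Fox functions; the separating lines are those on which the moments exist.

The formulas are then Mellin inversion (`foxH_of_mellin`). It needs the kernels to be integrable
along vertical lines, for which the bound `|Γ(s)| ≤ Γ(Re s + 2) / |s| ^ 2` is enough
(`Complex.norm_Gamma_le_div_normSq`). Since every separating line inverts the transform of the same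
function, the value does not depend on the line.
-/

/-! ### Gamma on vertical lines -/

theorem Complex.norm_Gamma_le_Gamma_re {s : ℂ} (hs : 0 < s.re) :
    ‖Complex.Gamma s‖ ≤ Real.Gamma s.re := by
  rw [Complex.Gamma_eq_integral hs, Real.Gamma_eq_integral hs, Complex.GammaIntegral]
  refine (norm_integral_le_integral_norm _).trans (le_of_eq ?_)
  refine setIntegral_congr_fun measurableSet_Ioi fun x hx => ?_
  have hx' : (0 : ℝ) < x := hx
  simp only [norm_mul, Complex.norm_cpow_eq_rpow_re_of_pos hx', Complex.norm_real, Real.norm_eq_abs,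
    Real.abs_exp, Complex.sub_re, Complex.one_re]

/-- Two steps of the functional equation trade the bound by `Γ(Re s)` for quadratic decay along
vertical lines. This is far from the true exponential decay, but enough for absolute
convergence of the Mellin-Barnes integrals. -/
theorem Complex.norm_Gamma_le_div_normSq {s : ℂ} (hs : 0 < s.re) :
    ‖Complex.Gamma s‖ ≤ Real.Gamma (s.re + 2) / (s.re ^ 2 + s.im ^ 2) := by
  have h0 : s ≠ 0 := by rintro rfl; simp at hs
  have h1 : s + 1 ≠ 0 := by
    intro h
    have := congrArg Complex.re h
    simp at this
    linarith
  have hΓ : Complex.Gamma (s + 1 + 1) = (s + 1) * s * Complex.Gamma s := by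
    rw [Complex.Gamma_add_one _ h1, Complex.Gamma_add_one _ h0, mul_assoc]
  have hb := Complex.norm_Gamma_le_Gamma_re (s := s + 1 + 1) (by simp; linarith)
  rw [hΓ, norm_mul, norm_mul] at hb
  have hre : (s + 1 + 1).re = s.re + 2 := by simp; ring
  rw [hre] at hb
  have hsq : s.re ^ 2 + s.im ^ 2 = ‖s‖ * ‖s‖ := by
    rw [Complex.norm_mul_self_eq_normSq, Complex.normSq_apply]; ring
  have hle : ‖s‖ ≤ ‖s + 1‖ := by
    rw [← sq_le_sq₀ (norm_nonneg _) (norm_nonneg _), ← Complex.normSq_eq_norm_sq,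
      ← Complex.normSq_eq_norm_sq, Complex.normSq_apply, Complex.normSq_apply]
    simp
    nlinarith
  have hpos : 0 < ‖s‖ := norm_pos_iff.2 h0
  rw [le_div_iff₀ (by rw [hsq]; positivity), hsq]
  refine le_trans ?_ hb
  rw [mul_comm]
  gcongr

theorem continuous_Gamma_vertical {b B c : ℝ} (h : 0 < b + B * c) :
    Continuous fun y : ℝ => Complex.Gamma (b + B * (c + y * Complex.I)) := by
  rw [continuous_iff_continuousAt]
  intro y
  have hd : DifferentiableAt ℂ Complex.Gamma (b + B * (c + y * Complex.I)) := by
    refine Complex.differentiableAt_Gamma _ fun m hm => ?_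
    have := congrArg Complex.re hm
    simp at this
    have hm0 : (0 : ℝ) ≤ m := m.cast_nonneg
    linarith
  exact ContinuousAt.comp (f := fun y : ℝ => (b + B * (c + y * Complex.I) : ℂ)) hd.continuousAt
    (by fun_prop)

theorem norm_Gamma_vertical_le {b B c : ℝ} (h : 0 < b + B * c) (y : ℝ) :
    ‖Complex.Gamma (b + B * (c + y * Complex.I))‖ ≤ Real.Gamma (b + B * c) := by
  have hre : ((b : ℂ) + B * (c + y * Complex.I)).re = b + B * c := by simp
  have := Complex.norm_Gamma_le_Gamma_re (s := b + B * (c + y * Complex.I)) (by rwa [hre])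
  rwa [hre] at this

theorem integrable_Gamma_vertical {b B c : ℝ} (hB : 0 < B) (h : 0 < b + B * c) :
    Integrable fun y : ℝ => Complex.Gamma (b + B * (c + y * Complex.I)) := by
  set β := b + B * c with hβ
  have hint : Integrable fun y : ℝ => Real.Gamma (β + 2) / β ^ 2 * (1 + (y * (B / β)) ^ 2)⁻¹ :=
    ((integrable_inv_one_add_sq).comp_mul_right' (by positivity : B / β ≠ 0)).const_mul _
  refine hint.mono' (continuous_Gamma_vertical h).aestronglyMeasurable (.of_forall fun y => ?_)
  have hre : ((b : ℂ) + B * (c + y * Complex.I)).re = β := by simp [hβ]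
  have him : ((b : ℂ) + B * (c + y * Complex.I)).im = B * y := by simp
  have := Complex.norm_Gamma_le_div_normSq (s := b + B * (c + y * Complex.I)) (by rwa [hre])
  rw [hre, him] at this
  refine this.trans (le_of_eq ?_)
  field_simp

theorem integrable_Gamma_mul_Gamma_vertical {b B c b' B' : ℝ} (hB : 0 < B) (h : 0 < b + B * c)
    (h' : 0 < b' + B' * c) :
    Integrable fun y : ℝ => Complex.Gamma (b + B * (c + y * Complex.I)) *
      Complex.Gamma (b' + B' * (c + y * Complex.I)) :=
  (integrable_Gamma_vertical hB h).mul_bdd (c := Real.Gamma (b' + B' * c))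
    (continuous_Gamma_vertical h').aestronglyMeasurable
    (.of_forall fun y => norm_Gamma_vertical_le h' y)

/-! ### Fox functions by Mellin inversion -/

/-- Mellin inversion for a function whose Mellin transform is `C * κ ^ s * K s`: the factor
`κ ^ s` rescales the argument of the inverse transform of `K`. -/
theorem mellinInv_div_eq_of_mellin {f : ℝ → ℂ} {K : ℂ → ℂ} {C : ℂ} (hC : C ≠ 0) {κ z c : ℝ}
    (hκ : 0 < κ) (hz : 0 < z) (hconv : MellinConvergent f c)
    (hK : Complex.VerticalIntegrable K c)
    (hm : ∀ y : ℝ, mellin f (c + y * Complex.I) =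
      C * (κ : ℂ) ^ ((c : ℂ) + y * Complex.I) * K (c + y * Complex.I))
    (hf : ContinuousAt f z) :
    f z = C * mellinInv c K (z / κ) := by
  have hκ' : (κ : ℂ) ≠ 0 := by exact_mod_cast hκ.ne'
  set g : ℝ → ℂ := fun t => f (κ * t) with hg
  have hgm : ∀ y : ℝ, mellin g (c + y * Complex.I) = C * K (c + y * Complex.I) := by
    intro y
    rw [hg, mellin_comp_mul_left _ _ hκ, hm, smul_eq_mul, Complex.cpow_neg]
    have : (κ : ℂ) ^ ((c : ℂ) + y * Complex.I) ≠ 0 := by simp [Complex.cpow_eq_zero_iff, hκ']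
    field_simp
  have hinv := mellinInv_mellin_eq c g (x := z / κ) (by positivity)
    ((MellinConvergent.comp_mul_left hκ).2 hconv)
    ((hK.const_mul C).congr (.of_forall fun y => (hgm y).symm))
    (by
      have : κ * (z / κ) = z := by field_simp
      exact ContinuousAt.comp (f := fun t : ℝ => κ * t) (by rw [this]; exact hf) (by fun_prop))
  have h1 : g (z / κ) = f z := by
    simp only [hg]; congr 1; field_simp
  rw [← h1, ← hinv]
  simp only [mellinInv, hgm, smul_eq_mul]
  rw [mul_smul_comm, ← integral_const_mul]
  congr 2
  ext y
  ring

/-- A function whose Mellin transform is `C * κ ^ s` times a Fox kernel on every separating line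
is `C` times the Fox function. Every line recovers the same function, so the value is
independent of the line. -/
theorem foxH_of_mellin {m n p q : ℕ} {a : Fin p → ℂ × ℝ} {b : Fin q → ℂ × ℝ} {f : ℝ → ℂ}
    {C : ℂ} (hC : C ≠ 0) {κ z : ℝ} (hκ : 0 < κ) (hz : 0 < z) (hf : ContinuousAt f z)
    (hex : ∃ c, FoxSeparates m n a b c)
    (h : ∀ c, FoxSeparates m n a b c → MellinConvergent f c ∧
      Complex.VerticalIntegrable (foxKernel m n a b) c ∧
      ∀ y : ℝ, mellin f (c + y * Complex.I) =
        C * (κ : ℂ) ^ ((c : ℂ) + y * Complex.I) * foxKernel m n a b (c + y * Complex.I)) :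
    FoxHWellDefined m n a b (z / κ) ∧ f z = C * foxH m n a b (z / κ) := by
  have hval : ∀ c, FoxSeparates m n a b c →
      f z = C * mellinInv c (foxKernel m n a b) (z / κ) := fun c hc =>
    mellinInv_div_eq_of_mellin hC hκ hz (h c hc).1 (h c hc).2.1 (h c hc).2.2 hf
  have hH : f z = C * foxH m n a b (z / κ) := by
    rw [foxH, dif_pos hex]
    exact hval _ hex.choose_spec
  refine ⟨⟨hex, fun c hc => ⟨?_, mul_left_cancel₀ hC ((hval c hc).symm.trans hH)⟩⟩, hH⟩
  have hx : 0 < z / κ := by positivity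
  refine (h c hc).2.1.bdd_mul (c := (z / κ) ^ (-c)) ?_ (.of_forall fun y => ?_)
  · refine Continuous.aestronglyMeasurable ?_
    refine Continuous.const_cpow (by fun_prop) (Or.inl ?_)
    exact_mod_cast hx.ne'
  · rw [Complex.norm_cpow_eq_rpow_re_of_pos hx]
    simp

/-! ### The distance to the `k`-th nearest point -/

/-- The distribution function of the Erlang law, by repeated integration by parts. -/
theorem cdf_gammaMeasure_nat {k : ℕ} (hk : 1 ≤ k) {x : ℝ} (hx : 0 ≤ x) :
    cdf (gammaMeasure k 1) x =
      1 - ∑ n ∈ Finset.range k, Real.exp (-x) * x ^ n / (n.factorial : ℝ) := by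
  obtain ⟨j, rfl⟩ : ∃ j, k = j + 1 := ⟨k - 1, by omega⟩
  rw [cdf_gammaMeasure_eq_integral (by positivity) one_pos]
  have h1 : ∫ t in Iic x, gammaPDFReal ((j + 1 : ℕ) : ℝ) 1 t =
      ∫ t in (0 : ℝ)..x, Real.exp (-t) * t ^ j / (j.factorial : ℝ) := by
    rw [intervalIntegral.integral_of_le hx, ← integral_Icc_eq_integral_Ioc]
    rw [setIntegral_eq_of_subset_of_forall_sdiff_eq_zero measurableSet_Iic Icc_subset_Iic_self]
    · refine setIntegral_congr_fun measurableSet_Icc fun t ht => ?_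
      simp only [gammaPDFReal, if_pos ht.1]
      push_cast
      rw [Real.Gamma_nat_eq_factorial, add_sub_cancel_right, Real.rpow_natCast, Real.one_rpow,
        one_mul]
      ring
    · intro t ht
      have : ¬ 0 ≤ t := fun h0 => ht.2 ⟨h0, ht.1⟩
      simp [gammaPDFReal, this]
  have hder : ∀ (j : ℕ) (t : ℝ), HasDerivAt (fun t : ℝ => 1 - ∑ n ∈ Finset.range (j + 1),
      Real.exp (-t) * t ^ n / (n.factorial : ℝ)) (Real.exp (-t) * t ^ j / (j.factorial : ℝ)) t := by
    intro j t
    -- the sum telescopes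
    induction j with
    | zero =>
      simpa using ((hasDerivAt_neg t).exp).const_sub 1
    | succ j ih =>
      have hexp : HasDerivAt (fun t : ℝ => Real.exp (-t)) (-Real.exp (-t)) t := by
        simpa using (hasDerivAt_neg t).exp
      have hterm := ((hexp.mul (hasDerivAt_pow (j + 1) t)).div_const
        ((j + 1).factorial : ℝ))
      have := ih.sub hterm
      refine (this.congr_of_eventuallyEq (.of_forall fun u => ?_)).congr_deriv ?_
      · simp only [Finset.sum_range_succ _ (j + 1), Pi.sub_apply, Pi.mul_apply]
        ring
      · rw [Nat.factorial_succ]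
        push_cast
        have : (j.factorial : ℝ) ≠ 0 := by positivity
        field_simp
        simp
  rw [h1, intervalIntegral.integral_eq_sub_of_hasDerivAt (fun t _ => hder j t)
    ((by fun_prop : Continuous fun t : ℝ => Real.exp (-t) * t ^ j / (j.factorial : ℝ)
      ).intervalIntegrable _ _)]
  have h0 : ∑ n ∈ Finset.range (j + 1), Real.exp (-(0 : ℝ)) * 0 ^ n / (n.factorial : ℝ) = 1 := by
    rw [Finset.sum_range_succ', Finset.sum_eq_zero] <;> simp
  rw [h0]
  ring

section NearestDist

variable {d : ℕ} {S : Set (EuclideanSpace ℝ (Fin d))} {k : ℕ}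

theorem kthNearestDist_nonneg : 0 ≤ kthNearestDist S k :=
  Real.sInf_nonneg fun _ h => h.1

/-- Local finiteness makes the counting function right-continuous, so that the infimum defining
the `k`-th distance is attained. -/
theorem kthNearestDist_le_iff (hS : ∀ R : ℝ, (S ∩ Metric.closedBall 0 R).Finite)
    (hne : ∃ R : ℝ, (k : ℕ∞) ≤ (S ∩ Metric.closedBall 0 R).encard) {ρ : ℝ} (hρ : 0 ≤ ρ) :
    kthNearestDist S k ≤ ρ ↔ (k : ℕ∞) ≤ (S ∩ Metric.closedBall 0 ρ).encard := by
  have hmono : ∀ {a b : ℝ}, a ≤ b → (S ∩ Metric.closedBall 0 a).encard ≤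
      (S ∩ Metric.closedBall 0 b).encard := fun hab =>
    encard_le_encard (inter_subset_inter_right _ (Metric.closedBall_subset_closedBall hab))
  have hbdd : BddBelow {ρ : ℝ | 0 ≤ ρ ∧ (k : ℕ∞) ≤ (S ∩ Metric.closedBall 0 ρ).encard} :=
    ⟨0, fun _ h => h.1⟩
  refine ⟨fun h => ?_, fun h => csInf_le hbdd ⟨hρ, h⟩⟩
  obtain ⟨R, hR⟩ := hne
  have hne' : {ρ : ℝ | 0 ≤ ρ ∧ (k : ℕ∞) ≤ (S ∩ Metric.closedBall 0 ρ).encard}.Nonempty :=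
    ⟨max R 0, le_max_right _ _, hR.trans (hmono (le_max_left _ _))⟩
  have hev : ∀ᶠ a in nhdsWithin ρ (Ioi ρ), ∀ x ∈ S ∩ Metric.closedBall 0 (ρ + 1),
      ‖x‖ ≤ a → ‖x‖ ≤ ρ := by
    rw [Filter.eventually_all_finite (hS _)]
    intro x _
    rcases le_or_gt ‖x‖ ρ with hx | hx
    · exact .of_forall fun _ _ => hx
    · filter_upwards [nhdsWithin_le_nhds (Iio_mem_nhds hx)] with a ha hxa
      exact absurd hxa (not_le.2 ha)
  obtain ⟨a, ha, haρ, ha1⟩ := (hev.and (Filter.Eventually.and (p := fun a => a ∈ Ioi ρ)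
    (q := fun a => a ∈ Iio (ρ + 1)) self_mem_nhdsWithin
    (nhdsWithin_le_nhds (Iio_mem_nhds (lt_add_one ρ))))).exists
  obtain ⟨b, ⟨_, hbk⟩, hba⟩ := exists_lt_of_csInf_lt hne' (h.trans_lt haρ)
  refine hbk.trans (encard_le_encard fun x hx => ⟨hx.1, ?_⟩)
  have hxb : ‖x‖ ≤ b := by simpa using hx.2
  have hxa : ‖x‖ ≤ a := hxb.trans hba.le
  have ha1' : a < ρ + 1 := ha1
  simpa using ha x ⟨hx.1, by simpa using hxa.trans ha1'.le⟩ hxa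

end NearestDist

section Poisson

variable {Ω : Type*} [MeasurableSpace Ω] {P : Measure Ω} [IsProbabilityMeasure P] {d : ℕ}
  {lam : ℝ} {Φ : Ω → Set (EuclideanSpace ℝ (Fin d))}

/-- The mean number of points in a ball, as `A * ρ ^ d` with `A` the intensity times the volume of
the unit ball. -/
theorem measureReal_closedBall_mul (hd : 0 < d) (lam : ℝ) {ρ : ℝ} (hρ : 0 ≤ ρ) :
    lam * volume.real (Metric.closedBall (0 : EuclideanSpace ℝ (Fin d)) ρ) =
      (Real.pi ^ ((d : ℝ) / 2) / Real.Gamma (1 + (d : ℝ) / 2) * lam) * ρ ^ d := by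
  have : Nonempty (Fin d) := ⟨⟨0, hd⟩⟩
  rw [Measure.real, EuclideanSpace.volume_closedBall, ENNReal.toReal_mul, ENNReal.toReal_pow,
    ENNReal.toReal_ofReal hρ, ENNReal.toReal_ofReal (div_nonneg (by positivity)
      (Real.Gamma_pos_of_pos (by positivity)).le), Fintype.card_fin, Real.sqrt_eq_rpow,
    ← Real.rpow_natCast (Real.pi ^ (1 / 2 : ℝ)), ← Real.rpow_mul Real.pi_pos.le, add_comm (1 : ℝ)]
  rw [show (1 / 2 : ℝ) * d = d / 2 by ring]
  ring

theorem IsHomogeneousPPP.measureReal_le_encard (hΦ : IsHomogeneousPPP P lam Φ) {k : ℕ} (hk : 1 ≤ k)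
    {B : Set (EuclideanSpace ℝ (Fin d))} (hB : MeasurableSet B) (hfin : volume B ≠ ⊤)
    (hlam : 0 ≤ lam) :
    P.real {ω | (k : ℕ∞) ≤ (Φ ω ∩ B).encard} = cdf (gammaMeasure k 1) (lam * volume.real B) := by
  rw [cdf_gammaMeasure_nat hk (by positivity)]
  have hcompl : {ω | (k : ℕ∞) ≤ (Φ ω ∩ B).encard} =
      (⋃ n ∈ Finset.range k, {ω | (Φ ω ∩ B).encard = (n : ℕ∞)})ᶜ := by
    ext ω
    simp only [mem_ofPred_eq, mem_compl_iff, mem_iUnion, Finset.mem_range, not_exists]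
    constructor
    · rintro h n hn he
      rw [he] at h
      exact absurd (Nat.cast_le.1 h) (by omega)
    · intro h
      by_contra! hlt
      obtain ⟨n, hn⟩ := ENat.ne_top_iff_exists.1 (ne_top_of_lt hlt)
      rw [← hn] at hlt
      exact h n (Nat.cast_lt.1 hlt) hn.symm
  have hms : ∀ n : ℕ, MeasurableSet {ω | (Φ ω ∩ B).encard = (n : ℕ∞)} := fun n =>
    hΦ.measurable_count B hB (measurableSet_singleton _)
  rw [hcompl, probReal_compl_eq_one_sub (Finset.measurableSet_biUnion _ fun n _ => hms n),
    measureReal_biUnion_finset _ (fun n _ => hms n)]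
  · congr 1
    refine Finset.sum_congr rfl fun n _ => ?_
    rw [Measure.real, hΦ.poisson_count B hB hfin, ENNReal.toReal_ofReal (by positivity)]
  · intro m _ n _ hmn
    refine Set.disjoint_left.2 fun ω h1 h2 => hmn ?_
    have h1' : (Φ ω ∩ B).encard = (m : ℕ∞) := h1
    have h2' : (Φ ω ∩ B).encard = (n : ℕ∞) := h2
    exact_mod_cast h1'.symm.trans h2'

/-- A homogeneous Poisson process has infinitely many points, so the `k`-th distance is almost
surely given by the counting function. -/
theorem IsHomogeneousPPP.ae_kthNearestDist_le_iff (hΦ : IsHomogeneousPPP P lam Φ) (hd : 0 < d)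
    (hlam : 0 < lam) {k : ℕ} (hk : 1 ≤ k) :
    ∀ᵐ ω ∂P, ∀ ρ : ℝ, 0 ≤ ρ → (kthNearestDist (Φ ω) k ≤ ρ ↔
      (k : ℕ∞) ≤ (Φ ω ∩ Metric.closedBall 0 ρ).encard) := by
  have hex : ∀ᵐ ω ∂P, ∃ R : ℝ, (k : ℕ∞) ≤ (Φ ω ∩ Metric.closedBall 0 R).encard := by
    set A := Real.pi ^ ((d : ℝ) / 2) / Real.Gamma (1 + (d : ℝ) / 2) * lam
    have hA : 0 < A := by
      have := Real.Gamma_pos_of_pos (show 0 < 1 + (d : ℝ) / 2 by positivity)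
      have := Real.pi_pos
      positivity
    set U := {ω | ∃ R : ℝ, (k : ℕ∞) ≤ (Φ ω ∩ Metric.closedBall 0 R).encard}
    have hle : ∀ n : ℕ, cdf (gammaMeasure k 1) (A * (n : ℝ) ^ d) ≤ P.real U := by
      intro n
      rw [← measureReal_closedBall_mul hd lam n.cast_nonneg, ← hΦ.measureReal_le_encard hk
        measurableSet_closedBall measure_closedBall_lt_top.ne hlam.le]
      exact measureReal_mono fun ω h => ⟨n, h⟩
    have : IsProbabilityMeasure (gammaMeasure k 1) :=
      isProbabilityMeasure_gammaMeasure (by positivity) one_pos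
    have hlim : Filter.Tendsto (fun n : ℕ => cdf (gammaMeasure k 1) (A * (n : ℝ) ^ d))
        Filter.atTop (nhds 1) :=
      (tendsto_cdf_atTop _).comp (Filter.Tendsto.const_mul_atTop hA
        ((Filter.tendsto_pow_atTop hd.ne').comp tendsto_natCast_atTop_atTop))
    have h1 : 1 ≤ P.real U := le_of_tendsto hlim (.of_forall hle)
    have hU : P U = 1 := le_antisymm prob_le_one (by
      rw [← ENNReal.ofReal_one]
      exact (ENNReal.ofReal_le_ofReal h1).trans_eq (ofReal_measureReal))
    have hmeas : MeasurableSet U := by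
      have : U = ⋃ n : ℕ, {ω | (k : ℕ∞) ≤ (Φ ω ∩ Metric.closedBall 0 (n : ℝ)).encard} := by
        ext ω
        simp only [U, mem_ofPred_eq, mem_iUnion]
        refine ⟨fun ⟨R, hR⟩ => ?_, fun ⟨n, hn⟩ => ⟨n, hn⟩⟩
        obtain ⟨n, hn⟩ := exists_nat_ge R
        exact ⟨n, hR.trans (encard_le_encard (inter_subset_inter_right _
          (Metric.closedBall_subset_closedBall hn)))⟩
      rw [this]
      exact MeasurableSet.iUnion fun n =>
        hΦ.measurable_count _ measurableSet_closedBall (Set.to_countable (Ici (k : ℕ∞))).measurableSet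
    exact (prob_compl_eq_zero_iff hmeas).2 hU
  filter_upwards [hex, hΦ.locallyFinite] with ω h1 h2 ρ hρ
  exact kthNearestDist_le_iff h2 h1 hρ

theorem IsHomogeneousPPP.aemeasurable_kthNearestDist (hΦ : IsHomogeneousPPP P lam Φ) (hd : 0 < d)
    (hlam : 0 < lam) {k : ℕ} (hk : 1 ≤ k) :
    AEMeasurable (fun ω => kthNearestDist (Φ ω) k) P := by
  refine NullMeasurable.aemeasurable ?_
  refine measurable_of_Iic (δ := NullMeasurableSpace Ω P) fun ρ => ?_
  change NullMeasurableSet {ω | kthNearestDist (Φ ω) k ≤ ρ} P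
  rcases lt_or_ge ρ 0 with hρ | hρ
  · convert! nullMeasurableSet_empty (μ := P)
    ext ω
    simpa using hρ.trans_le kthNearestDist_nonneg
  · refine NullMeasurableSet.congr (hΦ.measurable_count (Metric.closedBall 0 ρ)
      measurableSet_closedBall (Set.to_countable (Ici (k : ℕ∞))).measurableSet).nullMeasurableSet ?_
    filter_upwards [hΦ.ae_kthNearestDist_le_iff hd hlam hk] with ω h
    exact propext (h ρ hρ).symm

/-- The mapping theorem: the volumes of the balls reaching to the successive points, times the
intensity, form a unit rate process on the half-line, whose `k`-th point is gamma distributed. -/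
theorem IsHomogeneousPPP.hasLaw_kthNearestDist (hΦ : IsHomogeneousPPP P lam Φ) (hd : 0 < d)
    (hlam : 0 < lam) {k : ℕ} (hk : 1 ≤ k) :
    HasLaw (fun ω => Real.pi ^ ((d : ℝ) / 2) / Real.Gamma (1 + (d : ℝ) / 2) * lam *
      kthNearestDist (Φ ω) k ^ d) (gammaMeasure k 1) P := by
  have hd' : (d : ℝ) ≠ 0 := by positivity
  have hA0 : 0 < Real.pi ^ ((d : ℝ) / 2) / Real.Gamma (1 + (d : ℝ) / 2) * lam := by
    have := Real.Gamma_pos_of_pos (show 0 < 1 + (d : ℝ) / 2 by positivity)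
    have := Real.pi_pos
    positivity
  have hball := fun {ρ : ℝ} (hρ : 0 ≤ ρ) => measureReal_closedBall_mul hd lam hρ
  generalize Real.pi ^ ((d : ℝ) / 2) / Real.Gamma (1 + (d : ℝ) / 2) * lam = A at *
  have hmeas : AEMeasurable (fun ω => A * kthNearestDist (Φ ω) k ^ d) P :=
    ((hΦ.aemeasurable_kthNearestDist hd hlam hk).pow_const d).const_mul A
  refine ⟨hmeas, ?_⟩
  have : IsProbabilityMeasure (gammaMeasure k 1) :=
    isProbabilityMeasure_gammaMeasure (by positivity) one_pos
  have : IsProbabilityMeasure (P.map fun ω => A * kthNearestDist (Φ ω) k ^ d) :=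
    Measure.isProbabilityMeasure_map hmeas
  refine Measure.eq_of_cdf _ _ ?_
  ext x
  rw [cdf_eq_real, map_measureReal_apply_of_aemeasurable hmeas measurableSet_Iic]
  rcases lt_or_ge x 0 with hx | hx
  · have h1 : (fun ω => A * kthNearestDist (Φ ω) k ^ d) ⁻¹' Iic x = ∅ := by
      ext ω
      simp only [mem_preimage, mem_Iic, mem_empty_iff_false, iff_false, not_le]
      have := kthNearestDist_nonneg (S := Φ ω) (k := k)
      exact hx.trans_le (by positivity)
    rw [h1, measureReal_empty, cdf_gammaMeasure_eq_integral (by positivity) one_pos]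
    refine (setIntegral_eq_zero_of_forall_eq_zero fun t ht => ?_).symm
    have : ¬ 0 ≤ t := not_le.2 (lt_of_le_of_lt ht hx)
    simp [gammaPDFReal, this]
  · set ρ := (x / A) ^ (1 / (d : ℝ)) with hρ
    have hρ0 : 0 ≤ ρ := by positivity
    have hρd : A * ρ ^ d = x := by
      rw [hρ, ← Real.rpow_natCast, ← Real.rpow_mul (by positivity), one_div_mul_cancel hd',
        Real.rpow_one]
      field_simp
    rw [← hρd, ← hball hρ0, ← hΦ.measureReal_le_encard hk measurableSet_closedBall
      measure_closedBall_lt_top.ne hlam.le]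
    refine measureReal_congr ?_
    filter_upwards [hΦ.ae_kthNearestDist_le_iff hd hlam hk] with ω h
    refine propext (Iff.trans ?_ (h ρ hρ0))
    change A * kthNearestDist (Φ ω) k ^ d ≤ lam * volume.real (Metric.closedBall 0 ρ) ↔ _
    rw [hball hρ0, mul_le_mul_iff_right₀ hA0, pow_le_pow_iff_left₀ kthNearestDist_nonneg hρ0 hd.ne']

end Poisson

/-! ### Mellin transforms of densities and tails -/

section Density

variable {Ω : Type*} [MeasurableSpace Ω] {P : Measure Ω} {X : Ω → ℝ} {p : ℝ → ℝ}

theorem integrable_smul_iff_mellinConvergent (hp0 : ∀ x, x < 0 → p x = 0) (s : ℂ) :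
    Integrable (fun t : ℝ => p t • (t : ℂ) ^ (s - 1)) ↔
      MellinConvergent (fun t => (p t : ℂ)) s := by
  rw [MellinConvergent, ← integrableOn_Ici_iff_integrableOn_Ioi,
    ← integrableOn_iff_integrable_of_support_subset (s := Ici (0 : ℝ))]
  · simp only [smul_eq_mul, Complex.real_smul, mul_comm]
  · intro t ht
    by_contra h
    exact ht (by simp [hp0 t (not_le.1 h)])

theorem ProbabilityTheory.HasLaw.integrable_cpow_iff_mellinConvergent
    (hX : HasLaw X (volume.withDensity fun x => ENNReal.ofReal (p x)) P) (hpm : Measurable p)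
    (hpn : ∀ x, 0 ≤ p x) (hp0 : ∀ x, x < 0 → p x = 0) (s : ℂ) :
    Integrable (fun ω => (X ω : ℂ) ^ (s - 1)) P ↔ MellinConvergent (fun t => (p t : ℂ)) s := by
  have hm : Measurable fun t : ℝ => (t : ℂ) ^ (s - 1) := by fun_prop
  rw [← integrable_smul_iff_mellinConvergent hp0]
  have := integrable_map_measure (μ := P) (f := X) (g := fun t : ℝ => (t : ℂ) ^ (s - 1))
    hm.aestronglyMeasurable hX.aemeasurable
  rw [hX.map_eq, integrable_withDensity_iff_integrable_smul' (by fun_prop)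
    (.of_forall fun _ => ENNReal.ofReal_lt_top)] at this
  simpa only [ENNReal.toReal_ofReal (hpn _)] using! this.symm

theorem ProbabilityTheory.HasLaw.integral_cpow_eq_mellin
    (hX : HasLaw X (volume.withDensity fun x => ENNReal.ofReal (p x)) P) (hpm : Measurable p)
    (hpn : ∀ x, 0 ≤ p x) (hp0 : ∀ x, x < 0 → p x = 0) (s : ℂ) :
    ∫ ω, (X ω : ℂ) ^ (s - 1) ∂P = mellin (fun t => (p t : ℂ)) s := by
  have hm : Measurable fun t : ℝ => (t : ℂ) ^ (s - 1) := by fun_prop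
  have := hX.integral_comp (f := fun t : ℝ => (t : ℂ) ^ (s - 1)) hm.aestronglyMeasurable
  rw [integral_withDensity_eq_integral_toReal_smul (by fun_prop)
    (.of_forall fun _ => ENNReal.ofReal_lt_top)] at this
  refine (Eq.trans (by rfl) this).trans ?_
  simp only [ENNReal.toReal_ofReal (hpn _)]
  rw [mellin, ← integral_Ici_eq_integral_Ioi, setIntegral_eq_integral_of_forall_compl_eq_zero]
  · simp only [smul_eq_mul, Complex.real_smul, mul_comm]
  · intro t ht
    simp [hp0 t (not_le.1 ht)]

theorem ProbabilityTheory.HasLaw.ae_pos_of_density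
    (hX : HasLaw X (volume.withDensity fun x => ENNReal.ofReal (p x)) P) (hpm : Measurable p)
    (hp0 : ∀ x, x < 0 → p x = 0) : ∀ᵐ ω ∂P, 0 < X ω := by
  have hm : Measurable fun x : ℝ => 0 < x := measurableSet_setOfPred.1 measurableSet_Ioi
  rw [hX.ae_iff hm, ae_withDensity_iff (by fun_prop)]
  filter_upwards [Measure.ae_ne volume (0 : ℝ)] with x hx0 hx
  by_contra h
  exact hx (by simp [hp0 x (lt_of_le_of_ne (not_lt.1 h) hx0)])

end Density

/-- The Mellin transform of the tail of a law on `(0, ∞)`: by Fubini, the moment `s` divided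
by `s`. -/
theorem hasMellin_measureReal_Ioi {ν : Measure ℝ} [IsProbabilityMeasure ν]
    (hν : ∀ᵐ x ∂ν, 0 < x) {s : ℂ} (hs : 0 < s.re) (hint : Integrable (fun x : ℝ => (x : ℂ) ^ s) ν) :
    HasMellin (fun t => (ν.real (Ioi t) : ℂ)) s ((∫ x : ℝ, (x : ℂ) ^ s ∂ν) / s) := by
  have hs0 : s ≠ 0 := by rintro rfl; simp at hs
  set F : ℝ → ℝ → ℂ := fun t x => (Iio x).indicator (fun t : ℝ => (t : ℂ) ^ (s - 1)) t with hF
  have hFm : Measurable (Function.uncurry F) := by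
    have : Function.uncurry F = {q : ℝ × ℝ | q.1 < q.2}.indicator
        (fun q : ℝ × ℝ => (q.1 : ℂ) ^ (s - 1)) := by
      ext ⟨t, x⟩
      simp [F, Function.uncurry, indicator]
    rw [this]
    exact Measurable.indicator (by fun_prop) (measurableSet_lt measurable_fst measurable_snd)
  have hset : ∀ {x : ℝ}, Iio x ∩ Ioi 0 = Ioo 0 x := fun {x} => by
    ext t; simp [and_comm]
  have hre : -1 < (s - 1).re := by simpa using hs
  have hinner : ∀ x : ℝ, 0 < x → ∫ t in Ioi (0 : ℝ), F t x = (x : ℂ) ^ s / s := by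
    intro x hx
    simp only [F]
    rw [integral_indicator measurableSet_Iio, Measure.restrict_restrict measurableSet_Iio, hset,
      ← integral_Ioc_eq_integral_Ioo, ← intervalIntegral.integral_of_le hx.le,
      integral_cpow (Or.inl hre)]
    simp [hs0]
  have hinnerN : ∀ x : ℝ, 0 < x → ∫ t in Ioi (0 : ℝ), ‖F t x‖ = ‖(x : ℂ) ^ s‖ / s.re := by
    intro x hx
    simp only [F, norm_indicator_eq_indicator_norm]
    rw [integral_indicator measurableSet_Iio, Measure.restrict_restrict measurableSet_Iio, hset]
    have : ∫ t in Ioo 0 x, ‖(t : ℂ) ^ (s - 1)‖ = ∫ t in Ioo 0 x, t ^ (s.re - 1) :=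
      setIntegral_congr_fun measurableSet_Ioo fun t ht => by
        simp [Complex.norm_cpow_eq_rpow_re_of_pos ht.1]
    rw [this, ← integral_Ioc_eq_integral_Ioo, ← intervalIntegral.integral_of_le hx.le,
      integral_rpow (Or.inl (by simpa using hs)), Complex.norm_cpow_eq_rpow_re_of_pos hx]
    simp [hs.ne']
  have hI : Integrable (Function.uncurry F) ((volume.restrict (Ioi (0 : ℝ))).prod ν) := by
    rw [integrable_prod_iff' hFm.aestronglyMeasurable]
    refine ⟨?_, ?_⟩
    · filter_upwards [hν] with x hx
      simp only [Function.uncurry, F]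
      rw [integrable_indicator_iff measurableSet_Iio, IntegrableOn,
        Measure.restrict_restrict measurableSet_Iio, hset, ← IntegrableOn,
        ← integrableOn_Ioc_iff_integrableOn_Ioo, ← intervalIntegrable_iff_integrableOn_Ioc_of_le hx.le]
      exact intervalIntegral.intervalIntegrable_cpow' hre
    · refine (hint.norm.div_const s.re).congr ?_
      filter_upwards [hν] with x hx
      exact (hinnerN x hx).symm
  have hout : ∀ t : ℝ, ∫ x, F t x ∂ν = (t : ℂ) ^ (s - 1) • (ν.real (Ioi t) : ℂ) := by
    intro t
    have : (fun x => F t x) = (Ioi t).indicator fun _ => (t : ℂ) ^ (s - 1) := by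
      ext x
      simp [F, indicator]
    rw [this, integral_indicator_const _ measurableSet_Ioi]
    simp [mul_comm]
  refine ⟨?_, ?_⟩
  · refine (hI.integral_prod_left).congr (.of_forall fun t => ?_)
    exact hout t
  · rw [mellin]
    simp_rw [← hout]
    rw [integral_integral_swap hI, ← integral_div]
    refine integral_congr_ae ?_
    filter_upwards [hν] with x hx
    exact hinner x hx

theorem continuous_measureReal_Ioi {ν : Measure ℝ} [IsProbabilityMeasure ν] [NullSingletonClass ν] :
    Continuous fun t => ν.real (Ioi t) := by
  have h : ∀ t, ν.real (Ioi t) = 1 - cdf ν t := fun t => by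
    rw [cdf_eq_real, ← compl_Iic, probReal_compl_eq_one_sub measurableSet_Iic]
  simp_rw [h]
  refine continuous_const.sub (continuous_iff_continuousAt.2 fun t => ?_)
  rw [(monotone_cdf ν).continuousAt_iff_leftLim_eq_rightLim, StieltjesFunction.rightLim_eq]
  have h1 : (cdf ν).measure {t} = 0 := by rw [measure_cdf]; exact measure_singleton t
  rw [StieltjesFunction.measure_singleton, ENNReal.ofReal_eq_zero, sub_nonpos] at h1
  exact le_antisymm ((monotone_cdf ν).leftLim_le le_rfl) h1

/-! ### Ratios of independent variables -/

section Ratio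

variable {Ω : Type*} [MeasurableSpace Ω] {P : Measure Ω}
  {X T : Ω → ℝ} {p : ℝ → ℝ} {M : ℝ}

/-- The density of `X / T`, where `X` has density `p` and `T` has law `τ` and is independent
of `X`. -/
noncomputable def ratioPDF (p : ℝ → ℝ) (τ : Measure ℝ) (z : ℝ) : ℝ :=
  ∫ t, t * p (z * t) ∂τ

theorem ratioPDF_nonneg {τ : Measure ℝ} (hτ : ∀ᵐ t ∂τ, 0 < t) (hpn : ∀ x, 0 ≤ p x) (z : ℝ) :
    0 ≤ ratioPDF p τ z :=
  integral_nonneg_of_ae (by filter_upwards [hτ] with t ht using mul_nonneg ht.le (hpn _))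

theorem ratioPDF_of_nonpos {τ : Measure ℝ} (hτ : ∀ᵐ t ∂τ, 0 < t) (hp0 : ∀ x, x ≤ 0 → p x = 0)
    {z : ℝ} (hz : z ≤ 0) : ratioPDF p τ z = 0 := by
  refine integral_eq_zero_of_ae ?_
  filter_upwards [hτ] with t ht
  simp [hp0 _ (mul_nonpos_of_nonpos_of_nonneg hz ht.le)]

theorem measurable_ratioPDF {τ : Measure ℝ} [SFinite τ] (hpm : Measurable p) :
    Measurable (ratioPDF p τ) := by
  have : StronglyMeasurable (Function.uncurry fun z t : ℝ => t * p (z * t)) :=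
    (measurable_snd.mul (hpm.comp (measurable_fst.mul measurable_snd))).stronglyMeasurable
  exact this.integral_prod_right.measurable

theorem ratioPDF_eq_inv_mul (p : ℝ → ℝ) (τ : Measure ℝ) {z : ℝ} (hz : z ≠ 0) :
    ratioPDF p τ z = z⁻¹ * ∫ t, (z * t) * p (z * t) ∂τ := by
  rw [ratioPDF, ← integral_const_mul]
  congr 1
  ext t
  field_simp

theorem integrable_ratioPDF {τ : Measure ℝ} [IsFiniteMeasure τ]
    (hpm : Measurable p) (hp0 : ∀ x, x ≤ 0 → p x = 0)
    (hM : ∀ x, 0 < x → |x * p x| ≤ M) (hτ : ∀ᵐ t ∂τ, 0 < t) (z : ℝ) :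
    Integrable (fun t => t * p (z * t)) τ := by
  refine Integrable.mono' (integrable_const (|z⁻¹| * M))
    (by fun_prop) ?_
  filter_upwards [hτ] with t ht
  rcases le_or_gt z 0 with hz | hz
  · have hM0 := (abs_nonneg _).trans (hM 1 one_pos)
    rw [hp0 _ (mul_nonpos_of_nonpos_of_nonneg hz ht.le)]
    simpa using mul_nonneg (by positivity) hM0
  · have h1 : t * p (z * t) = z⁻¹ * (z * t * p (z * t)) := by field_simp
    rw [h1, Real.norm_eq_abs, abs_mul]
    gcongr
    exact hM _ (by positivity)

/-- Only `x * p x`, not `p` itself, has to be bounded, which covers densities that blow up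
at `0`. -/
theorem continuousAt_ratioPDF {τ : Measure ℝ} [IsFiniteMeasure τ] (hpm : Measurable p)
    (hpc : ContinuousOn p (Ioi 0)) (hM : ∀ x, 0 < x → |x * p x| ≤ M) (hτ : ∀ᵐ t ∂τ, 0 < t)
    {z : ℝ} (hz : 0 < z) : ContinuousAt (ratioPDF p τ) z := by
  have h1 : (fun z => z⁻¹ * ∫ t, (z * t) * p (z * t) ∂τ) =ᶠ[nhds z] ratioPDF p τ := by
    filter_upwards [Ioi_mem_nhds hz] with y hy
    exact (ratioPDF_eq_inv_mul p τ (ne_of_gt hy)).symm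
  refine ContinuousAt.congr ?_ h1
  refine (continuousAt_inv₀ hz.ne').mul ?_
  refine continuousAt_of_dominated (bound := fun _ => M) ?_ ?_ (integrable_const _) ?_
  · exact .of_forall fun y => by fun_prop
  · filter_upwards [Ioi_mem_nhds hz] with y hy
    filter_upwards [hτ] with t ht
    exact hM _ (mul_pos hy ht)
  · filter_upwards [hτ] with t ht
    have hc : ContinuousAt p (z * t) := hpc.continuousAt (Ioi_mem_nhds (by positivity))
    have hm : ContinuousAt (fun z : ℝ => z * t) z := by fun_prop
    exact hm.mul (ContinuousAt.comp (f := fun z : ℝ => z * t) hc hm)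

theorem hasLaw_div_ratioPDF [IsProbabilityMeasure P]
    (hX : HasLaw X (volume.withDensity fun x => ENNReal.ofReal (p x)) P) (hT : AEMeasurable T P)
    (hXT : IndepFun X T P) (hpm : Measurable p) (hpn : ∀ x, 0 ≤ p x)
    (hp0 : ∀ x, x ≤ 0 → p x = 0) (hM : ∀ x, 0 < x → |x * p x| ≤ M) (hTpos : ∀ᵐ ω ∂P, 0 < T ω) :
    HasLaw (fun ω => X ω / T ω)
      (volume.withDensity fun z => ENNReal.ofReal (ratioPDF p (P.map T) z)) P := by
  have hτprob : IsProbabilityMeasure (P.map T) := Measure.isProbabilityMeasure_map hT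
  have hτ : ∀ᵐ t ∂(P.map T), 0 < t :=
    (ae_map_iff hT measurableSet_Ioi).2 hTpos
  set τ := P.map T with hτdef
  refine ⟨hX.aemeasurable.div hT, ?_⟩
  have hpair : P.map (fun ω => (X ω, T ω)) =
      (volume.withDensity fun x => ENNReal.ofReal (p x)).prod τ := by
    rw [(indepFun_iff_map_prod_eq_prod_map_map hX.aemeasurable hT).1 hXT, hX.map_eq]
  have hdivm : Measurable fun q : ℝ × ℝ => q.1 / q.2 := by fun_prop
  have hmap : P.map (fun ω => X ω / T ω) =
      ((volume.withDensity fun x => ENNReal.ofReal (p x)).prod τ).map (fun q => q.1 / q.2) := by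
    rw [← hpair, AEMeasurable.map_map_of_aemeasurable hdivm.aemeasurable
      (hX.aemeasurable.prodMk hT)]
    rfl
  ext B hB
  rw [hmap, Measure.map_apply hdivm hB, Measure.prod_apply_symm (hdivm hB), withDensity_apply _ hB]
  have h1 : ∀ t : ℝ, 0 < t → (volume.withDensity fun x => ENNReal.ofReal (p x))
      ((fun x => (x, t)) ⁻¹' ((fun q : ℝ × ℝ => q.1 / q.2) ⁻¹' B)) =
        ∫⁻ z in B, ENNReal.ofReal (t * p (z * t)) := by
    intro t ht
    have hBt : MeasurableSet ((fun x => (x, t)) ⁻¹' ((fun q : ℝ × ℝ => q.1 / q.2) ⁻¹' B)) :=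
      measurable_prodMk_right (hdivm hB)
    rw [withDensity_apply _ hBt, ← lintegral_indicator hBt, ← lintegral_indicator hB]
    -- substitute `x = z * t`
    conv_lhs => rw [← Real.smul_map_volume_mul_right ht.ne']
    rw [lintegral_smul_measure, lintegral_map ((by fun_prop : Measurable fun x =>
      ENNReal.ofReal (p x)).indicator hBt) (by fun_prop), smul_eq_mul,
      ← lintegral_const_mul' _ _ ENNReal.ofReal_ne_top]
    congr 1
    ext z
    have hz : z * t / t = z := by field_simp
    by_cases hzB : z ∈ B
    · rw [indicator_of_mem hzB, indicator_of_mem (by simpa [hz] using hzB), abs_of_pos ht,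
        ENNReal.ofReal_mul ht.le]
    · rw [indicator_of_notMem hzB, indicator_of_notMem (by simpa [hz] using hzB), mul_zero]
  have h2 : ∀ᵐ t ∂τ, (volume.withDensity fun x => ENNReal.ofReal (p x))
      ((fun x => (x, t)) ⁻¹' ((fun q : ℝ × ℝ => q.1 / q.2) ⁻¹' B)) =
        ∫⁻ z in B, ENNReal.ofReal (t * p (z * t)) := by
    filter_upwards [hτ] with t ht using h1 t ht
  rw [lintegral_congr_ae h2, lintegral_lintegral_swap]
  · refine lintegral_congr fun z => ?_
    rw [ratioPDF, ofReal_integral_eq_lintegral_ofReal (integrable_ratioPDF hpm hp0 hM hτ z)]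
    filter_upwards [hτ] with t ht using mul_nonneg ht.le (hpn _)
  · exact (by fun_prop : Measurable (Function.uncurry fun t z : ℝ =>
      ENNReal.ofReal (t * p (z * t)))).aemeasurable

theorem ae_div_cpow (hXnn : ∀ᵐ ω ∂P, 0 ≤ X ω) (hTpos : ∀ᵐ ω ∂P, 0 < T ω) (w : ℂ) :
    (fun ω => ((X ω / T ω : ℝ) : ℂ) ^ w) =ᵐ[P]
      fun ω => ((X ω : ℂ) ^ w) * ((T ω : ℂ) ^ (-w)) := by
  filter_upwards [hXnn, hTpos] with ω h1 h2
  rw [div_eq_mul_inv, Complex.ofReal_mul, Complex.mul_cpow_ofReal_nonneg h1 (by positivity),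
    Complex.ofReal_inv, Complex.inv_cpow, Complex.cpow_neg]
  rw [Complex.arg_ofReal_of_nonneg h2.le]
  exact Real.pi_pos.ne

theorem ProbabilityTheory.IndepFun.integrable_div_cpow (hXT : IndepFun X T P)
    (hXnn : ∀ᵐ ω ∂P, 0 ≤ X ω) (hTpos : ∀ᵐ ω ∂P, 0 < T ω) {w : ℂ}
    (hX : Integrable (fun ω => (X ω : ℂ) ^ w) P)
    (hT : Integrable (fun ω => (T ω : ℂ) ^ (-w)) P) :
    Integrable (fun ω => ((X ω / T ω : ℝ) : ℂ) ^ w) P := by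
  refine Integrable.congr ?_ (ae_div_cpow hXnn hTpos w).symm
  exact IndepFun.integrable_mul (hXT.comp (φ := fun x : ℝ => (x : ℂ) ^ w)
    (ψ := fun x : ℝ => (x : ℂ) ^ (-w)) (by fun_prop) (by fun_prop)) hX hT

theorem ProbabilityTheory.IndepFun.integral_div_cpow (hXT : IndepFun X T P)
    (hXnn : ∀ᵐ ω ∂P, 0 ≤ X ω) (hTpos : ∀ᵐ ω ∂P, 0 < T ω) {w : ℂ}
    (hX : Integrable (fun ω => (X ω : ℂ) ^ w) P)
    (hT : Integrable (fun ω => (T ω : ℂ) ^ (-w)) P) :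
    ∫ ω, ((X ω / T ω : ℝ) : ℂ) ^ w ∂P =
      (∫ ω, (X ω : ℂ) ^ w ∂P) * ∫ ω, (T ω : ℂ) ^ (-w) ∂P := by
  rw [integral_congr_ae (ae_div_cpow hXnn hTpos w)]
  exact IndepFun.integral_fun_mul_eq_mul_integral (hXT.comp (φ := fun x : ℝ => (x : ℂ) ^ w)
    (ψ := fun x : ℝ => (x : ℂ) ^ (-w)) (by fun_prop) (by fun_prop)) hX.aestronglyMeasurable
    hT.aestronglyMeasurable

end Ratio

/-! ### Mellin transforms of the gamma and power gain densities -/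

theorem hasMellin_exp_neg {s : ℂ} (hs : 0 < s.re) :
    HasMellin (fun t : ℝ => (Real.exp (-t) : ℂ)) s (Complex.Gamma s) := by
  refine ⟨?_, ?_⟩
  · simpa only [MellinConvergent, smul_eq_mul, mul_comm] using! Complex.GammaIntegral_convergent hs
  · rw [Complex.Gamma_eq_integral hs, Complex.GammaIntegral_eq_mellin]

theorem hasMellin_gammaPDFReal {a : ℝ} {s : ℂ} (hs : 0 < s.re + a - 1) :
    HasMellin (fun t : ℝ => (gammaPDFReal a 1 t : ℂ)) s
      (Complex.Gamma (s + a - 1) / Real.Gamma a) := by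
  have hre : 0 < (s + ((a : ℂ) - 1)).re := by simpa [← add_sub_assoc] using hs
  have h := hasMellin_exp_neg hre
  have h1 : EqOn (fun t : ℝ => (gammaPDFReal a 1 t : ℂ))
      (fun t : ℝ => (1 / Real.Gamma a : ℂ) • ((t : ℂ) ^ ((a : ℂ) - 1) • (Real.exp (-t) : ℂ)))
      (Ioi 0) := by
    intro t ht
    have ht' : 0 < t := ht
    simp only [gammaPDFReal, if_pos ht'.le, smul_eq_mul, Real.one_rpow, one_mul]
    push_cast [Complex.ofReal_cpow ht'.le]
    ring
  have hconv := (MellinConvergent.cpow_smul.2 h.1)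
  obtain ⟨h2, h3⟩ := hasMellin_const_smul hconv (1 / Real.Gamma a : ℂ)
  refine ⟨?_, ?_⟩
  · refine (integrableOn_congr_fun (fun t ht => ?_) measurableSet_Ioi).2 h2
    simp only [h1 ht]
  · rw [mellin_cpow_smul, h.2] at h3
    rw [show s + a - 1 = s + ((a : ℂ) - 1) by ring]
    refine Eq.trans (setIntegral_congr_fun measurableSet_Ioi fun t ht => ?_) (h3.trans ?_)
    · simp only [h1 ht]
    · rw [smul_eq_mul]; ring

section AlphaMu

variable {α μ Om : ℝ}

theorem alphaMuPowerPDF_nonneg (hα : 0 ≤ α) (hμ : 0 < μ) (hOm : 0 ≤ Om) (x : ℝ) :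
    0 ≤ alphaMuPowerPDF α μ Om x := by
  unfold alphaMuPowerPDF
  have := Real.Gamma_pos_of_pos hμ
  split_ifs <;> positivity

theorem alphaMuPowerPDF_of_nonpos {x : ℝ} (hx : x ≤ 0) : alphaMuPowerPDF α μ Om x = 0 :=
  if_neg hx.not_gt

theorem measurable_alphaMuPowerPDF : Measurable (alphaMuPowerPDF α μ Om) :=
  Measurable.ite measurableSet_Ioi (by fun_prop) measurable_const

theorem continuousOn_alphaMuPowerPDF : ContinuousOn (alphaMuPowerPDF α μ Om) (Ioi 0) := by
  have : ContinuousOn (fun x : ℝ => α * x ^ (α * μ / 2 - 1) /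
      (2 * Om ^ (α * μ / 2) * Real.Gamma μ) * Real.exp (-(x / Om) ^ (α / 2))) (Ioi 0) := by
    refine fun x hx => ContinuousAt.continuousWithinAt ?_
    have hx0 : x ≠ 0 := ne_of_gt hx
    by_cases hOm : Om = 0
    · simp only [hOm, div_zero]
      exact ((continuousAt_const.mul (Real.continuousAt_rpow_const _ _ (Or.inl hx0))).div_const
        _).mul continuousAt_const
    refine ((continuousAt_const.mul (Real.continuousAt_rpow_const _ _ (Or.inl hx0))).div_const
        _).mul (Real.continuous_exp.continuousAt.comp (ContinuousAt.neg ?_))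
    exact ContinuousAt.rpow_const (by fun_prop) (Or.inl (div_ne_zero hx0 hOm))
  refine this.congr fun x hx => if_pos hx

/-- With `y = (x / Om) ^ (α / 2)` the product is a multiple of `y ^ μ * exp (-y)`, which is
largest at `y = μ`. -/
theorem exists_abs_mul_alphaMuPowerPDF_le (hα : 0 < α) (hμ : 0 < μ) (hOm : 0 < Om) :
    ∃ M, ∀ x, 0 < x → |x * alphaMuPowerPDF α μ Om x| ≤ M := by
  refine ⟨α / (2 * Real.Gamma μ) * Real.exp (μ * Real.log μ - μ), fun x hx => ?_⟩
  have hΓ := Real.Gamma_pos_of_pos hμ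
  rw [abs_of_nonneg (mul_nonneg hx.le (alphaMuPowerPDF_nonneg hα.le hμ hOm.le x)),
    alphaMuPowerPDF, if_pos hx]
  set y := (x / Om) ^ (α / 2) with hy
  have hy0 : 0 < y := by positivity
  have h1 : x * x ^ (α * μ / 2 - 1) / Om ^ (α * μ / 2) = Real.exp (μ * Real.log y) := by
    rw [← Real.rpow_one_add' hx.le (by ring_nf; positivity), mul_comm μ, ← Real.rpow_def_of_pos hy0,
      hy, ← Real.rpow_mul (by positivity), Real.div_rpow hx.le hOm.le]
    congr 2 <;> ring
  have h2 : μ * Real.log y - y ≤ μ * Real.log μ - μ := by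
    have := Real.log_le_sub_one_of_pos (div_pos hy0 hμ)
    rw [Real.log_div hy0.ne' hμ.ne'] at this
    have := mul_le_mul_of_nonneg_left this hμ.le
    have e : μ * (y / μ - 1) = y - μ := by field_simp
    linarith
  calc x * (α * x ^ (α * μ / 2 - 1) / (2 * Om ^ (α * μ / 2) * Real.Gamma μ) * Real.exp (-y))
      = α / (2 * Real.Gamma μ) * ((x * x ^ (α * μ / 2 - 1) / Om ^ (α * μ / 2)) *
          Real.exp (-y)) := by field_simp
    _ ≤ _ := by
      rw [h1, ← Real.exp_add, ← sub_eq_add_neg]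
      gcongr

theorem hasMellin_alphaMuPowerPDF (hα : 0 < α) (hμ : 0 < μ) (hOm : 0 < Om) {s : ℂ}
    (hs : 0 < μ + 2 / α * (s.re - 1)) :
    HasMellin (fun t : ℝ => (alphaMuPowerPDF α μ Om t : ℂ)) s
      ((Om : ℂ) ^ (s - 1) * Complex.Gamma (μ + (2 / α : ℝ) * (s - 1)) / Real.Gamma μ) := by
  have hα' : (α : ℂ) ≠ 0 := by exact_mod_cast hα.ne'
  have hOm' : (Om : ℂ) ≠ 0 := by exact_mod_cast hOm.ne'
  have hΓ : (Real.Gamma μ : ℂ) ≠ 0 := by exact_mod_cast (Real.Gamma_pos_of_pos hμ).ne'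
  set a : ℂ := ((α * μ / 2 - 1 : ℝ) : ℂ) with ha
  have harg : (s + a) / ((α / 2 : ℝ) : ℂ) = μ + (2 / α : ℝ) * (s - 1) := by
    rw [ha]; push_cast; field_simp; ring
  have hre : 0 < ((s + a) / ((α / 2 : ℝ) : ℂ)).re := by
    rw [harg]; simpa using hs
  have hE := hasMellin_exp_neg hre
  set E2 : ℝ → ℂ := fun t => (Real.exp (-(t ^ (α / 2))) : ℂ) with hE2
  have hE2conv : MellinConvergent E2 (s + a) :=
    (MellinConvergent.comp_rpow (f := fun t : ℝ => (Real.exp (-t) : ℂ)) (by positivity)).2 hE.1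
  have hE2m : mellin E2 (s + a) = |α / 2|⁻¹ • Complex.Gamma (μ + (2 / α : ℝ) * (s - 1)) := by
    rw [hE2, mellin_comp_rpow (fun t : ℝ => (Real.exp (-t) : ℂ)), hE.2, harg]
  have hOmi : 0 < Om⁻¹ := inv_pos.2 hOm
  have hconv := MellinConvergent.cpow_smul.2 ((MellinConvergent.comp_mul_left hOmi).2 hE2conv)
  set C : ℂ := ((α / (2 * Om ^ (α * μ / 2) * Real.Gamma μ) : ℝ) : ℂ) with hC
  obtain ⟨h2, h3⟩ := hasMellin_const_smul hconv C
  have h1 : EqOn (fun t : ℝ => (alphaMuPowerPDF α μ Om t : ℂ))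
      (fun t : ℝ => C • ((t : ℂ) ^ a • E2 (Om⁻¹ * t))) (Ioi 0) := by
    intro t ht
    have ht' : 0 < t := ht
    simp only [alphaMuPowerPDF, if_pos ht', hC, hE2, ha, smul_eq_mul, ← Complex.ofReal_cpow ht'.le,
      ← Complex.ofReal_mul]
    congr 1
    rw [inv_mul_eq_div]
    ring
  refine ⟨?_, ?_⟩
  · refine (integrableOn_congr_fun (fun t ht => ?_) measurableSet_Ioi).2 h2
    simp only [h1 ht]
  · rw [mellin_cpow_smul, mellin_comp_mul_left _ _ hOmi, hE2m, abs_of_pos (by positivity)] at h3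
    refine Eq.trans (setIntegral_congr_fun measurableSet_Ioi fun t ht => ?_) (h3.trans ?_)
    · simp only [h1 ht]
    · have e1 : ((Om⁻¹ : ℝ) : ℂ) ^ (-(s + a)) = (Om : ℂ) ^ (s - 1) * ((Om ^ (α * μ / 2) : ℝ) : ℂ) := by
        rw [Complex.ofReal_inv, Complex.inv_cpow _ _
          (by rw [Complex.arg_ofReal_of_nonneg hOm.le]; exact Real.pi_pos.ne),
          ← Complex.cpow_neg, neg_neg, Complex.ofReal_cpow hOm.le, ← Complex.cpow_add _ _ hOm']
        congr 1
        rw [ha]; push_cast; ring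
      rw [e1, hC]
      have hOp : ((Om ^ (α * μ / 2) : ℝ) : ℂ) ≠ 0 := by
        exact_mod_cast (Real.rpow_pos_of_pos hOm _).ne'
      simp only [smul_eq_mul, Complex.real_smul]
      push_cast at hOp ⊢
      field_simp

end AlphaMu

/-! ### Moments of the two factors -/

section Moments

variable {Ω : Type*} [MeasurableSpace Ω] {P : Measure Ω} {g T : Ω → ℝ}

theorem moment_alphaMuPower {α μ Om : ℝ} (hα : 0 < α) (hμ : 0 < μ) (hOm : 0 < Om)
    (hg : HasLaw g (volume.withDensity fun x => ENNReal.ofReal (alphaMuPowerPDF α μ Om x)) P)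
    {w : ℂ} (hw : 0 < μ + 2 / α * w.re) :
    Integrable (fun ω => (g ω : ℂ) ^ w) P ∧ ∫ ω, (g ω : ℂ) ^ w ∂P =
      (Om : ℂ) ^ w * Complex.Gamma (μ + (2 / α : ℝ) * w) / Real.Gamma μ := by
  have h := hasMellin_alphaMuPowerPDF (s := w + 1) hα hμ hOm (by simpa using hw)
  have hn := alphaMuPowerPDF_nonneg hα.le hμ hOm.le
  have hz : ∀ x, x < 0 → alphaMuPowerPDF α μ Om x = 0 := fun x hx => alphaMuPowerPDF_of_nonpos hx.le
  have h1 := (hg.integrable_cpow_iff_mellinConvergent measurable_alphaMuPowerPDF hn hz (w + 1)).2 h.1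
  have h2 := hg.integral_cpow_eq_mellin measurable_alphaMuPowerPDF hn hz (w + 1)
  rw [h.2] at h2
  simp only [add_sub_cancel_right] at h1 h2
  exact ⟨h1, h2⟩

theorem moment_gamma {G : Ω → ℝ} {a : ℝ} (ha : 0 < a) (hG : HasLaw G (gammaMeasure a 1) P) {w : ℂ}
    (hw : 0 < a + w.re) :
    Integrable (fun ω => (G ω : ℂ) ^ w) P ∧
      ∫ ω, (G ω : ℂ) ^ w ∂P = Complex.Gamma (a + w) / Real.Gamma a := by
  have h := hasMellin_gammaPDFReal (a := a) (s := w + 1) (by rw [Complex.add_re, Complex.one_re]; linarith)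
  have hn := gammaPDFReal_nonneg ha one_pos
  have hz : ∀ x, x < 0 → gammaPDFReal a 1 x = 0 := fun x hx => if_neg (not_le.2 hx)
  have h1 := (HasLaw.integrable_cpow_iff_mellinConvergent hG
    (measurable_gammaPDFReal a 1) hn hz (w + 1)).2 h.1
  have h2 := HasLaw.integral_cpow_eq_mellin hG
    (measurable_gammaPDFReal a 1) hn hz (w + 1)
  rw [h.2] at h2
  rw [show w + 1 + (a : ℂ) - 1 = a + w by ring] at h2
  simp only [add_sub_cancel_right] at h1 h2
  exact ⟨h1, h2⟩

/-- Moments of `T` when `A * T ^ δ` is gamma distributed. -/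
theorem moment_of_gamma_rpow {a A δ : ℝ} (ha : 0 < a) (hA : 0 < A) (hδ : 0 < δ)
    (hT0 : ∀ ω, 0 ≤ T ω) (hT : HasLaw (fun ω => A * T ω ^ δ) (gammaMeasure a 1) P) {w : ℂ}
    (hw : 0 < a - 1 / δ * w.re) :
    Integrable (fun ω => (T ω : ℂ) ^ (-w)) P ∧ ∫ ω, (T ω : ℂ) ^ (-w) ∂P =
      ((A ^ (1 / δ) : ℝ) : ℂ) ^ w * Complex.Gamma (a - (1 / δ : ℝ) * w) / Real.Gamma a := by
  obtain ⟨h1, h2⟩ := moment_gamma (w := -((1 / δ : ℝ) * w)) ha hT (by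
    simpa [sub_eq_add_neg] using hw)
  rw [← sub_eq_add_neg] at h2
  have hB : 0 < A ^ (1 / δ) := by positivity
  have hB' : ((A ^ (1 / δ) : ℝ) : ℂ) ≠ 0 := by exact_mod_cast hB.ne'
  have key : ∀ ω, (T ω : ℂ) ^ (-w) = ((A ^ (1 / δ) : ℝ) : ℂ) ^ w *
      ((A * T ω ^ δ : ℝ) : ℂ) ^ (-((1 / δ : ℝ) * w)) := by
    intro ω
    have hT := hT0 ω
    rw [← mul_neg, Complex.cpow_mul_ofReal_nonneg (by positivity),
      Real.mul_rpow hA.le (by positivity), ← Real.rpow_mul hT, mul_one_div_cancel hδ.ne',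
      Real.rpow_one, Complex.ofReal_mul, Complex.mul_cpow_ofReal_nonneg hB.le hT, ← mul_assoc,
      ← Complex.cpow_add _ _ hB', add_neg_cancel, Complex.cpow_zero, one_mul]
  simp only [key]
  exact ⟨h1.const_mul _, by rw [integral_const_mul, h2]; ring⟩

end Moments

/-! ### The two Fox kernels -/

section FoxParameters

variable {κ₀ : ℝ} {μ α δ c : ℝ}

/-- Of the poles of the two Gamma factors, those closest to the line have index `0`. -/
theorem foxSeparates_pdf_iff (hα : 0 < α) (hδ : 0 < δ) :
    FoxSeparates 1 1 ![(((1 - κ₀ - 1 / δ : ℝ) : ℂ), 1 / δ)] ![(((μ - 2 / α : ℝ) : ℂ), 2 / α)] c ↔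
      0 < μ + 2 / α * (c - 1) ∧ 0 < κ₀ - 1 / δ * (c - 1) := by
  have h1 : ∀ ν : ℕ, (-(((μ - 2 / α : ℝ) : ℂ) + (ν : ℂ)) / ((2 / α : ℝ) : ℂ)).re =
      -(μ - 2 / α + ν) / (2 / α) := fun ν => by
    rw [Complex.div_ofReal_re]; simp
  have h2 : ∀ ν : ℕ, ((1 - ((1 - κ₀ - 1 / δ : ℝ) : ℂ) + (ν : ℂ)) / ((1 / δ : ℝ) : ℂ)).re =
      (1 - (1 - κ₀ - 1 / δ) + ν) / (1 / δ) := fun ν => by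
    rw [Complex.div_ofReal_re]; simp
  simp only [FoxSeparates, Fin.forall_fin_one, Matrix.cons_val_fin_one, Fin.val_zero, zero_lt_one,
    forall_true_left, h1, h2, div_lt_iff₀ (show 0 < 2 / α by positivity),
    lt_div_iff₀ (show 0 < 1 / δ by positivity)]
  constructor
  · rintro ⟨ha, hb⟩
    have ha0 := ha 0
    have hb0 := hb 0
    push_cast at ha0 hb0
    constructor <;> linarith
  · rintro ⟨ha, hb⟩
    refine ⟨fun ν => ?_, fun ν => ?_⟩ <;>
    · have : (0 : ℝ) ≤ ν := ν.cast_nonneg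
      linarith

theorem foxSeparates_ccdf_iff (hα : 0 < α) (hμ : 0 < μ) (hδ : 0 < δ) :
    FoxSeparates 2 1 ![(((1 - κ₀ : ℝ) : ℂ), 1 / δ), (1, 1)] ![(0, 1), ((μ : ℂ), 2 / α)] c ↔
      0 < c ∧ 0 < κ₀ - 1 / δ * c := by
  have h1 : ∀ ν : ℕ, (-((μ : ℂ) + (ν : ℂ)) / ((2 / α : ℝ) : ℂ)).re =
      -(μ + ν) / (2 / α) := fun ν => by
    rw [Complex.div_ofReal_re]; simp
  have h2 : ∀ ν : ℕ, ((1 - ((1 - κ₀ : ℝ) : ℂ) + (ν : ℂ)) / ((1 / δ : ℝ) : ℂ)).re =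
      (1 - (1 - κ₀) + ν) / (1 / δ) := fun ν => by
    rw [Complex.div_ofReal_re]; simp
  have h3 : ∀ ν : ℕ, (-((0 : ℂ) + (ν : ℂ)) / ((1 : ℝ) : ℂ)).re = -(ν : ℝ) := fun ν => by simp
  have hα' : 0 < 2 / α := by positivity
  simp only [FoxSeparates, Fin.forall_fin_two, Matrix.cons_val_zero, Matrix.cons_val_one,
    Fin.val_zero, Fin.val_one, zero_lt_one, zero_lt_two, one_lt_two, lt_irrefl, false_imp_iff,
    and_true, forall_true_left, h1, h2, h3, div_lt_iff₀ hα',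
    lt_div_iff₀ (show 0 < 1 / δ by positivity)]
  constructor
  · rintro ⟨⟨ha, _⟩, hb⟩
    have ha0 := ha 0
    have hb0 := hb 0
    push_cast at ha0 hb0
    constructor <;> linarith
  · rintro ⟨ha, hb⟩
    have := mul_pos ha hα'
    refine ⟨⟨fun ν => ?_, fun ν => ?_⟩, fun ν => ?_⟩ <;>
    · have : (0 : ℝ) ≤ ν := ν.cast_nonneg
      linarith

theorem foxKernel_pdf (s : ℂ) :
    foxKernel 1 1 ![(((1 - κ₀ - 1 / δ : ℝ) : ℂ), 1 / δ)] ![(((μ - 2 / α : ℝ) : ℂ), 2 / α)] s =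
      Complex.Gamma (μ + (2 / α : ℝ) * (s - 1)) * Complex.Gamma (κ₀ - (1 / δ : ℝ) * (s - 1)) := by
  simp only [foxKernel, Finset.prod_filter, Fin.prod_univ_one, Matrix.cons_val_fin_one,
    Fin.val_zero, zero_lt_one, if_true, nonpos_iff_eq_zero, one_ne_zero, if_false, mul_one, div_one]
  congr 2 <;> push_cast <;> ring

/-- The quotient `Γ(s) / Γ(1 + s)` in the kernel is `1 / s`. -/
theorem foxKernel_ccdf {s : ℂ} (hs : 0 < s.re) :
    foxKernel 2 1 ![(((1 - κ₀ : ℝ) : ℂ), 1 / δ), (1, 1)] ![(0, 1), ((μ : ℂ), 2 / α)] s =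
      Complex.Gamma (μ + (2 / α : ℝ) * s) * Complex.Gamma (κ₀ - (1 / δ : ℝ) * s) / s := by
  have hs0 : s ≠ 0 := by rintro rfl; simp at hs
  have hΓ : Complex.Gamma s ≠ 0 := Complex.Gamma_ne_zero_of_re_pos hs
  simp [foxKernel, Finset.prod_filter, Fin.prod_univ_two]
  rw [add_comm (1 : ℂ) s, Complex.Gamma_add_one _ hs0]
  field_simp

theorem integrable_Gamma_mul_Gamma_sub (hα : 0 < α) (h1 : 0 < μ + 2 / α * c)
    (h2 : 0 < κ₀ - 1 / δ * c) :
    Integrable fun y : ℝ => Complex.Gamma (μ + (2 / α : ℝ) * (c + y * Complex.I)) *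
      Complex.Gamma (κ₀ - (1 / δ : ℝ) * (c + y * Complex.I)) := by
  have := integrable_Gamma_mul_Gamma_vertical (b' := κ₀) (B' := -(1 / δ))
    (show 0 < 2 / α by positivity) h1 (by linarith)
  simpa only [Complex.ofReal_neg, neg_mul, ← sub_eq_add_neg] using this

theorem verticalIntegrable_foxKernel_pdf (hα : 0 < α) (h1 : 0 < μ + 2 / α * (c - 1))
    (h2 : 0 < κ₀ - 1 / δ * (c - 1)) :
    Complex.VerticalIntegrable (foxKernel 1 1 ![(((1 - κ₀ - 1 / δ : ℝ) : ℂ), 1 / δ)]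
      ![(((μ - 2 / α : ℝ) : ℂ), 2 / α)]) c := by
  have := integrable_Gamma_mul_Gamma_sub hα h1 h2
  refine this.congr (.of_forall fun y => ?_)
  simp only [foxKernel_pdf]
  push_cast
  congr 3 <;> ring

theorem verticalIntegrable_foxKernel_ccdf (hα : 0 < α) (hc : 0 < c) (h1 : 0 < μ + 2 / α * c)
    (h2 : 0 < κ₀ - 1 / δ * c) :
    Complex.VerticalIntegrable (foxKernel 2 1 ![(((1 - κ₀ : ℝ) : ℂ), 1 / δ), (1, 1)]
      ![(0, 1), ((μ : ℂ), 2 / α)]) c := by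
  have hre : ∀ y : ℝ, ((c : ℂ) + y * Complex.I).re = c := fun y => by simp
  have hne : ∀ y : ℝ, (c : ℂ) + y * Complex.I ≠ 0 := fun y h => by
    have := congrArg Complex.re h
    rw [hre] at this
    simp at this
    linarith
  have := (integrable_Gamma_mul_Gamma_sub hα h1 h2).mul_bdd (c := c⁻¹)
    (g := fun y : ℝ => ((c : ℂ) + y * Complex.I)⁻¹)
    (Continuous.aestronglyMeasurable (Continuous.inv₀ (by fun_prop) hne))
    (.of_forall fun y => by
      rw [norm_inv]
      gcongr
      calc c = ((c : ℂ) + y * Complex.I).re := (hre y).symm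
        _ ≤ _ := Complex.re_le_norm _)
  refine this.congr (.of_forall fun y => ?_)
  beta_reduce
  rw [foxKernel_ccdf (by rw [hre]; exact hc), ← div_eq_mul_inv]

end FoxParameters

/-! ### Density and distribution function of the ratio -/

theorem lemma1 {Ω : Type*} [MeasurableSpace Ω] (P : Measure Ω) [IsProbabilityMeasure P]
    (d : ℕ) (hd : 0 < d) (k : ℕ) (hk : 1 ≤ k)
    (lam_b υ α μ : ℝ) (hlam : 0 < lam_b) (hυ : 0 < υ) (hα : 0 < α) (hμ : 0 < μ)
    -- the constants of the statement
    (δ c_d A Om ε θ : ℝ)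
    (hδ : δ = d / υ)
    (hc : c_d = Real.pi ^ ((d : ℝ) / 2) / Real.Gamma (1 + (d : ℝ) / 2))
    (hA : A = c_d * lam_b)
    (hOm : Om = Real.Gamma μ / Real.Gamma (μ + 2 / α))
    (hε : ε = 1 / (Om * Real.Gamma μ))
    (hθ : θ = 1 / Om)
    -- the legitimate users, and the power gain of the `k`-th nearest one
    (Φ : Ω → Set (EuclideanSpace ℝ (Fin d))) (hΦ : IsHomogeneousPPP P lam_b Φ)
    (r g Z : Ω → ℝ)
    (hr : ∀ ω, r ω = kthNearestDist (Φ ω) k)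
    (hg : HasLaw g (volume.withDensity fun x => ENNReal.ofReal (alphaMuPowerPDF α μ Om x)) P)
    (hgr : IndepFun g r P)
    (hZ : ∀ ω, Z ω = g ω / r ω ^ υ) :
    -- in the plane the constant `A` is `π λ_b`
    (d = 2 → A = Real.pi * lam_b) ∧
    -- the density of `Z`
    (∃ f : ℝ → ℝ,
      (∀ z, 0 ≤ f z) ∧ (∀ z, z ≤ 0 → f z = 0) ∧
      HasLaw Z (volume.withDensity fun z => ENNReal.ofReal (f z)) P ∧
      ∀ z, 0 < z →
        FoxHWellDefined 1 1
          ![((1 - k - 1 / δ : ℝ), 1 / δ)]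
          ![((μ - 2 / α : ℝ), 2 / α)]
          (θ * z / A ^ (1 / δ)) ∧
        (f z : ℂ) = ((ε / (A ^ (1 / δ) * Real.Gamma k) : ℝ) : ℂ) *
          foxH 1 1
            ![((1 - k - 1 / δ : ℝ), 1 / δ)]
            ![((μ - 2 / α : ℝ), 2 / α)]
            (θ * z / A ^ (1 / δ))) ∧
    -- the distribution function of `Z`
    (∀ z, z ≤ 0 → P.real {ω | Z ω ≤ z} = 0) ∧
    (∀ z, 0 < z →
      FoxHWellDefined 2 1
        ![((1 - k : ℝ), 1 / δ), (1, 1)]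
        ![(0, 1), (μ, 2 / α)]
        (θ * z / A ^ (1 / δ)) ∧
      (P.real {ω | Z ω ≤ z} : ℂ) = 1 - ((ε / (θ * Real.Gamma k) : ℝ) : ℂ) *
        foxH 2 1
          ![((1 - k : ℝ), 1 / δ), (1, 1)]
          ![(0, 1), (μ, 2 / α)]
          (θ * z / A ^ (1 / δ))) := by
  have hd0 : (0 : ℝ) < d := by exact_mod_cast hd
  have hk0 : (0 : ℝ) < k := by exact_mod_cast hk
  have hδ0 : 0 < δ := by rw [hδ]; positivity
  have hΓμ := Real.Gamma_pos_of_pos hμ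
  have hΓk := Real.Gamma_pos_of_pos hk0
  have hOm0 : 0 < Om := by
    have := Real.Gamma_pos_of_pos (show 0 < μ + 2 / α by positivity)
    rw [hOm]; positivity
  have hA0 : 0 < A := by
    have := Real.Gamma_pos_of_pos (show 0 < 1 + (d : ℝ) / 2 by positivity)
    have := Real.pi_pos
    rw [hA, hc]; positivity
  have hB0 : 0 < A ^ (1 / δ) := by positivity
  set κ := Om * A ^ (1 / δ) with hκ
  have hκ0 : 0 < κ := by positivity
  -- the argument of both Fox functions
  have hx : ∀ z, θ * z / A ^ (1 / δ) = z / κ := fun z => by rw [hθ, hκ]; field_simp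
  -- the path loss `T = r ^ υ`, for which `A * T ^ δ` is gamma distributed
  obtain rfl : r = fun ω => kthNearestDist (Φ ω) k := funext hr
  set T : Ω → ℝ := fun ω => kthNearestDist (Φ ω) k ^ υ with hTdef
  have hT0 : ∀ ω, 0 ≤ T ω := fun ω => Real.rpow_nonneg kthNearestDist_nonneg _
  have hTm : AEMeasurable T P := (hΦ.aemeasurable_kthNearestDist hd hlam hk).pow_const υ
  have hTlaw : HasLaw (fun ω => A * T ω ^ δ) (gammaMeasure k 1) P := by
    convert! hΦ.hasLaw_kthNearestDist hd hlam hk using 3 with ω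
    · rw [hA, hc]
    · rw [hTdef, ← Real.rpow_mul kthNearestDist_nonneg, hδ, mul_div_cancel₀ _ hυ.ne',
        Real.rpow_natCast]
  have hTpos : ∀ᵐ ω ∂P, 0 < T ω := by
    have := HasLaw.ae_pos_of_density hTlaw (measurable_gammaPDFReal k 1)
      (fun x hx => if_neg (not_le.2 hx))
    filter_upwards [this] with ω h
    refine lt_of_le_of_ne (hT0 ω) fun h0 => ?_
    rw [← h0, Real.zero_rpow hδ0.ne', mul_zero] at h
    exact h.false
  have hgT : IndepFun g T P := hgr.comp measurable_id (measurable_id.pow_const υ)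
  obtain rfl : Z = fun ω => g ω / T ω := funext hZ
  set p := alphaMuPowerPDF α μ Om with hp
  have hpm : Measurable p := measurable_alphaMuPowerPDF
  have hpn : ∀ x, 0 ≤ p x := alphaMuPowerPDF_nonneg hα.le hμ hOm0.le
  have hp0 : ∀ x, x ≤ 0 → p x = 0 := fun x hx => alphaMuPowerPDF_of_nonpos hx
  obtain ⟨M, hM⟩ := exists_abs_mul_alphaMuPowerPDF_le hα hμ hOm0
  have hgpos : ∀ᵐ ω ∂P, 0 < g ω := hg.ae_pos_of_density hpm fun x hx => hp0 x hx.le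
  -- the moments of `Z`
  have hmom : ∀ w : ℂ, 0 < μ + 2 / α * w.re → 0 < k - 1 / δ * w.re →
      Integrable (fun ω => ((g ω / T ω : ℝ) : ℂ) ^ w) P ∧
      ∫ ω, ((g ω / T ω : ℝ) : ℂ) ^ w ∂P = (κ : ℂ) ^ w *
        (Complex.Gamma (μ + (2 / α : ℝ) * w) * Complex.Gamma ((k : ℝ) - (1 / δ : ℝ) * w)) /
          (Real.Gamma μ * Real.Gamma k) := by
    intro w h1 h2
    obtain ⟨hi1, he1⟩ := moment_alphaMuPower hα hμ hOm0 hg h1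
    obtain ⟨hi2, he2⟩ := moment_of_gamma_rpow hk0 hA0 hδ0 hT0 hTlaw h2
    have hgnn := hgpos.mono fun ω h => h.le
    refine ⟨hgT.integrable_div_cpow hgnn hTpos hi1 hi2, ?_⟩
    rw [hgT.integral_div_cpow hgnn hTpos hi1 hi2, he1, he2, hκ, Complex.ofReal_mul,
      Complex.mul_cpow_ofReal_nonneg hOm0.le hB0.le]
    ring
  set f := ratioPDF p (P.map T) with hf
  have hτ : ∀ᵐ t ∂(P.map T), 0 < t := (ae_map_iff hTm measurableSet_Ioi).2 hTpos
  have hτprob : IsProbabilityMeasure (P.map T) := Measure.isProbabilityMeasure_map hTm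
  have hZlaw : HasLaw (fun ω => g ω / T ω) (volume.withDensity fun z => ENNReal.ofReal (f z)) P :=
    hasLaw_div_ratioPDF hg hTm hgT hpm hpn hp0 hM hTpos
  have hfm : Measurable f := measurable_ratioPDF hpm
  have hfn : ∀ z, 0 ≤ f z := ratioPDF_nonneg hτ hpn
  have hf0 : ∀ z, z ≤ 0 → f z = 0 := fun z hz => ratioPDF_of_nonpos hτ hp0 hz
  have hκ' : (κ : ℂ) ≠ 0 := by exact_mod_cast hκ0.ne'
  have hΓμ' : (Real.Gamma μ : ℂ) ≠ 0 := by exact_mod_cast hΓμ.ne'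
  have hΓk' : (Real.Gamma k : ℂ) ≠ 0 := by exact_mod_cast hΓk.ne'
  refine ⟨?_, ⟨f, hfn, hf0, hZlaw, fun z hz => ?_⟩, fun z hz => ?_, fun z hz => ?_⟩
  · rintro rfl
    rw [hA, hc]
    norm_num [Real.Gamma_two]
  · have hC : ((ε / (A ^ (1 / δ) * Real.Gamma k) : ℝ) : ℂ) ≠ 0 := by
      rw [hε]
      exact_mod_cast (by positivity : 0 < 1 / (Om * Real.Gamma μ) / (A ^ (1 / δ) * Real.Gamma k)).ne'
    rw [hx]
    -- the line `Re s = 1` separates, as both conditions hold where the moment is `E[Z ^ 0]`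
    refine foxH_of_mellin (f := fun z => (f z : ℂ)) hC hκ0 hz ?_ ⟨1, ?_⟩ fun c hc => ?_
    · exact Complex.continuous_ofReal.continuousAt.comp (f := f)
        (continuousAt_ratioPDF hpm continuousOn_alphaMuPowerPDF hM hτ hz)
    · rw [foxSeparates_pdf_iff hα hδ0]
      constructor <;> simpa
    · obtain ⟨h1, h2⟩ := (foxSeparates_pdf_iff hα hδ0).1 hc
      refine ⟨?_, verticalIntegrable_foxKernel_pdf hα h1 h2, fun y => ?_⟩
      · exact (hZlaw.integrable_cpow_iff_mellinConvergent hfm hfn (fun x hx => hf0 x hx.le) _).1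
          (hmom _ (by simpa using h1) (by simpa using h2)).1
      · have := (hmom (c + y * Complex.I - 1) (by simpa using h1) (by simpa using h2)).2
        refine (hZlaw.integral_cpow_eq_mellin hfm hfn (fun x hx => hf0 x hx.le) _).symm.trans
          (this.trans ?_)
        rw [foxKernel_pdf, Complex.cpow_sub _ _ hκ', Complex.cpow_one, hε, hκ]
        have hOm' : (Om : ℂ) ≠ 0 := by exact_mod_cast hOm0.ne'
        have hB' : ((A ^ (1 / δ) : ℝ) : ℂ) ≠ 0 := by exact_mod_cast hB0.ne'
        simp only [Complex.ofReal_div, Complex.ofReal_mul, Complex.ofReal_one] at hB' ⊢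
        field_simp
  · rw [hZlaw.measureReal_eq (p := fun x => x ≤ z) measurableSet_Iic, Measure.real,
      show {x | x ≤ z} = Iic z from rfl, withDensity_apply _ measurableSet_Iic,
      setLIntegral_eq_zero measurableSet_Iic fun x hx => by
        simp [hf0 x (le_trans hx hz)]]
    rfl
  · set ν := P.map fun ω => g ω / T ω with hν
    have hZm : AEMeasurable (fun ω => g ω / T ω) P := hZlaw.aemeasurable
    have : IsProbabilityMeasure ν := Measure.isProbabilityMeasure_map hZm
    have : NullSingletonClass ν := by rw [hν, hZlaw.map_eq]; infer_instance
    have hνpos : ∀ᵐ x ∂ν, 0 < x := (ae_map_iff hZm measurableSet_Ioi).2 (by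
      filter_upwards [hgpos, hTpos] with ω h1 h2 using div_pos h1 h2)
    have hC : ((ε / (θ * Real.Gamma k) : ℝ) : ℂ) = 1 / (Real.Gamma μ * Real.Gamma k) := by
      rw [hε, hθ, ← Complex.ofReal_mul, ← Complex.ofReal_one, ← Complex.ofReal_div]
      congr 1
      field_simp
    have hC0 : ((ε / (θ * Real.Gamma k) : ℝ) : ℂ) ≠ 0 := by
      rw [hC]; exact one_div_ne_zero (mul_ne_zero hΓμ' hΓk')
    have hcdf : P.real {ω | g ω / T ω ≤ z} = 1 - ν.real (Ioi z) := by
      rw [← compl_Iic, probReal_compl_eq_one_sub measurableSet_Iic, sub_sub_cancel, hν,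
        map_measureReal_apply_of_aemeasurable hZm measurableSet_Iic]
      rfl
    have hmel : ∀ s : ℂ, 0 < s.re → 0 < k - 1 / δ * s.re →
        HasMellin (fun t => (ν.real (Ioi t) : ℂ)) s ((κ : ℂ) ^ s *
        (Complex.Gamma (μ + (2 / α : ℝ) * s) * Complex.Gamma ((k : ℝ) - (1 / δ : ℝ) * s)) /
          (Real.Gamma μ * Real.Gamma k) / s) := by
      intro s hs h2
      obtain ⟨hi, he⟩ := hmom s (by positivity) h2
      have hmeas : Measurable fun x : ℝ => (x : ℂ) ^ s := by fun_prop
      rw [← he, ← integral_map (f := fun x : ℝ => (x : ℂ) ^ s) hZm hmeas.aestronglyMeasurable]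
      exact hasMellin_measureReal_Ioi hνpos hs
        ((integrable_map_measure hmeas.aestronglyMeasurable hZm).2 hi)
    rw [hx, hcdf, Complex.ofReal_sub 1 (ν.real (Ioi z)), Complex.ofReal_one, sub_right_inj]
    -- the separating lines are those with `0 < Re s < k * δ`
    refine foxH_of_mellin (f := fun t => (ν.real (Ioi t) : ℂ)) hC0 hκ0 hz ?_ ⟨k * δ / 2, ?_⟩ fun c hc => ?_
    · exact (Complex.continuous_ofReal.comp continuous_measureReal_Ioi).continuousAt
    · rw [foxSeparates_ccdf_iff hα hμ hδ0]
      have hhalf : 1 / δ * (k * δ / 2) = k / 2 := by field_simp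
      exact ⟨by positivity, by rw [hhalf]; linarith⟩
    · obtain ⟨h1, h2⟩ := (foxSeparates_ccdf_iff hα hμ hδ0).1 hc
      refine ⟨(hmel c (by simpa using h1) (by simpa using h2)).1,
        verticalIntegrable_foxKernel_ccdf hα h1 (by positivity) h2, fun y => ?_⟩
      rw [(hmel _ (by simpa using h1) (by simpa using h2)).2,
        foxKernel_ccdf (by simpa using h1), hC]
      ring
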